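/- Let $p_I,p_x,p_y,p_z\ge 0$ with $p_I+p_x+p_y+p_z=1$, and let $$\rho = p_I|\Phi^+\rangle\langle\Phi^+| + p_x|\Psi^+\rangle\langle\Psi^+| + p_y|\Psi^-\rangle\langle\Psi^-| + p_z|\Phi^-\rangle\langle\Phi^-|$$ be the corresponding Bell-diagonal state of two qubits $A,B$, where $|\Phi^\pm\rangle=(|00\rangle\pm|11\rangle)/\sqrt2$ and $|\Psi^\pm\rangle=(|01\rangle\pm|10\rangle)/\sqrt2$. Put $$\alpha_1=p_I-p_x-p_y+p_z,\qquad \alpha_2=\sqrt2\,(p_I-p_z),\qquad \alpha_3=\sqrt2\,(p_x-p_y).$$ Say that $\rho$ has a symmetric extension if there is a state (a positive semidefinite operator of trace one) $\tau$ on $A\otimes B\otimes B'$, with $B'$ a copy of $B$, that is invariant under conjugation by the swap of $B$ and $B'$ and satisfies $\operatorname{tr}_{B'}\tau=\rho$. Then $\rho$ has a symmetric extension if and only if at least one of the following three conditions holds: 1. $4\alpha_1(\alpha_2^2-\alpha_3^2)-(\alpha_2^2-\alpha_3^2)^2-4\alpha_1^2(\alpha_2^2+\alpha_3^2)\ge 0$;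 2. $\alpha_2^2-\alpha_3^2-2\sqrt2\,\alpha_1|\alpha_2|\ge 0$ and $|\alpha_2|-2\sqrt2\,\alpha_1\ge 0$; 3. $\alpha_3^2-\alpha_2^2+2\sqrt2\,\alpha_1|\alpha_3|\ge 0$ and $|\alpha_3|+2\sqrt2\,\alpha_1\ge 0$. Moreover, at least one of these three conditions holds if and only if $$4\sqrt{\det\rho}\ \ge\ \operatorname{tr}(\rho^2)-\tfrac12(\operatorname{tr}\rho)^2,$$ and this inequality is in turn equivalent to $\operatorname{tr}[(\rho^B)^2]\ge\operatorname{tr}(\rho^2)-4\sqrt{\det\rho}$, where $\rho^B=\operatorname{tr}_A\rho$. -/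

import Mathlib

open scoped ComplexOrder

noncomputable section

namespace SymExt

/-- A quantum state (density matrix): positive semidefinite with unit trace. -/
def IsState {n : Type*} [Fintype n] (ρ : Matrix n n ℂ) : Prop :=
  ρ.PosSemidef ∧ ρ.trace = 1

/-- The partial trace over the system `B'` of an operator on `A ⊗ B ⊗ B'`. -/
def traceB' {A B : Type*} [Fintype B] (τ : Matrix (A × B × B) (A × B × B) ℂ) :
    Matrix (A × B) (A × B) ℂ :=
  Matrix.of fun i j => ∑ b, τ (i.1, i.2, b) (j.1, j.2, b)

/-- The partial trace over the system `A` of an operator on `A ⊗ B`. -/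
def traceA {A B : Type*} [Fintype A] (ρ : Matrix (A × B) (A × B) ℂ) : Matrix B B ℂ :=
  Matrix.of fun b b' => ∑ a, ρ (a, b) (a, b')

/-- The unitary `𝟙_A ⊗ P_{BB'}`, where `P_{BB'}` swaps the systems `B` and `B'`:
it maps the basis vector `|a, b, b'⟩` to `|a, b', b⟩`. -/
def swapBB' (A B : Type*) [DecidableEq A] [DecidableEq B] :
    Matrix (A × B × B) (A × B × B) ℂ :=
  Matrix.of fun i j => if i = (j.1, j.2.2, j.2.1) then 1 else 0

/-- `ρ` on `A ⊗ B` has a symmetric extension (to two copies of `B`): there is a state on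
`A ⊗ B ⊗ B'` that is invariant under the swap of `B` and `B'` and reduces to `ρ` on `A ⊗ B`. -/
def HasSymmetricExtension {A B : Type*} [Fintype A] [Fintype B] [DecidableEq A] [DecidableEq B]
    (ρ : Matrix (A × B) (A × B) ℂ) : Prop :=
  ∃ τ : Matrix (A × B × B) (A × B × B) ℂ,
    IsState τ ∧ swapBB' A B * τ * (swapBB' A B).conjTranspose = τ ∧ traceB' τ = ρ

/-- The computational basis vector `|a b⟩` of two qubits. -/
def ket (a b : Fin 2) : Fin 2 × Fin 2 → ℂ := Pi.single (a, b) 1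

/-- `|v⟩⟨v|`. -/
def proj {n : Type*} (v : n → ℂ) : Matrix n n ℂ := Matrix.vecMulVec v (star v)

/-- `|Φ⁺⟩ = (|00⟩ + |11⟩)/√2`. -/
def phiPlus : Fin 2 × Fin 2 → ℂ := ((1 / √2 : ℝ) : ℂ) • (ket 0 0 + ket 1 1)

/-- `|Φ⁻⟩ = (|00⟩ - |11⟩)/√2`. -/
def phiMinus : Fin 2 × Fin 2 → ℂ := ((1 / √2 : ℝ) : ℂ) • (ket 0 0 - ket 1 1)

/-- `|Ψ⁺⟩ = (|01⟩ + |10⟩)/√2`. -/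
def psiPlus : Fin 2 × Fin 2 → ℂ := ((1 / √2 : ℝ) : ℂ) • (ket 0 1 + ket 1 0)

/-- `|Ψ⁻⟩ = (|01⟩ - |10⟩)/√2`. -/
def psiMinus : Fin 2 × Fin 2 → ℂ := ((1 / √2 : ℝ) : ℂ) • (ket 0 1 - ket 1 0)

/-- The Bell-diagonal operator `pI |Φ⁺⟩⟨Φ⁺| + px |Ψ⁺⟩⟨Ψ⁺| + py |Ψ⁻⟩⟨Ψ⁻| + pz |Φ⁻⟩⟨Φ⁻|`. -/
def bellDiagonal (pI px py pz : ℝ) : Matrix (Fin 2 × Fin 2) (Fin 2 × Fin 2) ℂ :=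
  (pI : ℂ) • proj phiPlus + (px : ℂ) • proj psiPlus
    + (py : ℂ) • proj psiMinus + (pz : ℂ) • proj phiMinus

/-- The first (rank-one) condition. -/
def Cond1 (α₁ α₂ α₃ : ℝ) : Prop :=
  4 * α₁ * (α₂ ^ 2 - α₃ ^ 2) - (α₂ ^ 2 - α₃ ^ 2) ^ 2 - 4 * α₁ ^ 2 * (α₂ ^ 2 + α₃ ^ 2) ≥ 0

/-- The second (rank-two) condition. -/
def Cond2 (α₁ α₂ α₃ : ℝ) : Prop :=
  α₂ ^ 2 - α₃ ^ 2 - 2 * √2 * α₁ * |α₂| ≥ 0 ∧ |α₂| - 2 * √2 * α₁ ≥ 0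

/-- The third (rank-two) condition. -/
def Cond3 (α₁ α₂ α₃ : ℝ) : Prop :=
  α₃ ^ 2 - α₂ ^ 2 + 2 * √2 * α₁ * |α₃| ≥ 0 ∧ |α₃| + 2 * √2 * α₁ ≥ 0

/-- `4 √(det ρ) ≥ tr ρ² - (tr ρ)²/2`; for Hermitian `ρ` all three quantities are real, so
passing to real parts loses nothing. -/
def BellCriterion (ρ : Matrix (Fin 2 × Fin 2) (Fin 2 × Fin 2) ℂ) : Prop :=
  4 * √(ρ.det.re) ≥ (ρ ^ 2).trace.re - 1 / 2 * ρ.trace.re ^ 2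

/-- `tr (ρ^B)² ≥ tr ρ² - 4 √(det ρ)`, with `ρ^B` the reduced state on `B`. -/
def TwoQubitCriterion (ρ : Matrix (Fin 2 × Fin 2) (Fin 2 × Fin 2) ℂ) : Prop :=
  (traceA ρ ^ 2).trace.re ≥ (ρ ^ 2).trace.re - 4 * √(ρ.det.re)

end SymExt

end

/-!
Write `q = √p` for each of the four Bell weights. Everything is compared with the inequality

  `|pI + pz - px - py| ≤ 2 √(pI pz) + 2 √(px py)`,

which says `|qI - qz| ≤ qx + qy` and `|qx - qy| ≤ qI + qz`, i.e. that the four numbers `q` are the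
side lengths of a (possibly degenerate) planar quadrilateral.

*Necessity.* If `τ` is a symmetric extension, compressing it to the vectors
`|Φ⁺⟩|k⟩, |Φ⁻⟩σ_z|k⟩` and summing over `k` gives a positive semidefinite `2 × 2` matrix with
diagonal `pI, pz`; likewise for `|Ψ⁺⟩|k⟩, |Ψ⁻⟩σ_z|k⟩`, with diagonal `px, py`. Swap invariance forces the
difference of the two off-diagonal entries to be `(pI + pz - px - py) / 2`, so the inequality is
Cauchy–Schwarz (`abs_le_of_hasSymmetricExtension`).

*Sufficiency.* A quadrilateral with sides `q` is a choice of phases making the sum of the four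
Bell amplitudes vanish. With such phases, and suitable signs, the vectors `∑ᵢ vᵢ |Bellᵢ⟩ ⊗ σᵢ|k⟩`, `k = 0, 1`, have no
component along the singlet of `B B'`, so they are swap symmetric; their equal mixture is an
extension (`hasSymmetricExtension_of_abs_le`). In the computational basis only the diagonal `L` of
the quadrilateral and the differences `u`, `t` of the sides on either side of it occur.

*The scalar conditions.* Squaring the inequality gives `4 √(det ρ) ≥ tr ρ² - 1/2`. In terms of the
`α`'s this reads `R ≤ √(A B)` with `A = 16 pI pz`, `B = 16 px py` and `R = α₁² + α₂² + α₃² - 1`.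
The first condition is exactly `R² ≤ A B`; the other two imply `R ≤ 0` and cover what is left of
the region `R ≤ 0` (`conditions_iff_le_sqrt`).
-/

open scoped ComplexOrder

noncomputable section

namespace SymExt

/-! ### Entries of the Bell-diagonal state -/

lemma inv_sqrt_two_mul_self : ((√2 : ℝ) : ℂ)⁻¹ * ((√2 : ℝ) : ℂ)⁻¹ = 1 / 2 := by
  rw [← mul_inv, ← Complex.ofReal_mul, Real.mul_self_sqrt (by norm_num)]
  norm_num

/-- In the computational basis a Bell-diagonal operator is supported on the two blocks
`{00, 11}` and `{01, 10}`. -/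
lemma bellDiagonal_apply (pI px py pz : ℝ) (i j : Fin 2 × Fin 2) :
    bellDiagonal pI px py pz i j = (((if i = j then
        (if i.1 = i.2 then (pI + pz) / 2 else (px + py) / 2)
      else if i.1 ≠ j.1 ∧ i.2 ≠ j.2 then
        (if i.1 = i.2 then (pI - pz) / 2 else (px - py) / 2)
      else 0 : ℝ)) : ℂ) := by
  have h := inv_sqrt_two_mul_self
  obtain ⟨a, b⟩ := i
  obtain ⟨c, d⟩ := j
  fin_cases a <;> fin_cases b <;> fin_cases c <;> fin_cases d <;>
    simp [bellDiagonal, proj, phiPlus, phiMinus, psiPlus, psiMinus, ket, Matrix.vecMulVec_apply,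
      h] <;> ring

lemma trace_bellDiagonal (pI px py pz : ℝ) :
    (bellDiagonal pI px py pz).trace = ((pI + px + py + pz : ℝ) : ℂ) := by
  simp [Matrix.trace, Fintype.sum_prod_type, bellDiagonal_apply]
  ring

lemma trace_bellDiagonal_sq (pI px py pz : ℝ) :
    (bellDiagonal pI px py pz ^ 2).trace = ((pI ^ 2 + px ^ 2 + py ^ 2 + pz ^ 2 : ℝ) : ℂ) := by
  simp [Matrix.trace, pow_two, Matrix.mul_apply, Fintype.sum_prod_type, bellDiagonal_apply]
  ring

lemma det_bellDiagonal (pI px py pz : ℝ) :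
    (bellDiagonal pI px py pz).det = ((pI * px * py * pz : ℝ) : ℂ) := by
  rw [← Matrix.det_reindex_self finProdFinEquiv]
  simp [Matrix.det_succ_row_zero, Fin.sum_univ_succ, bellDiagonal_apply, finProdFinEquiv,
    Fin.divNat, Fin.modNat, Fin.succAbove]
  ring

/-- The reduced state of a Bell-diagonal operator is a multiple of the identity. -/
lemma trace_traceA_bellDiagonal_sq (pI px py pz : ℝ) :
    (traceA (bellDiagonal pI px py pz) ^ 2).trace =
      (((pI + px + py + pz) ^ 2 / 2 : ℝ) : ℂ) := by
  simp [Matrix.trace, pow_two, Matrix.mul_apply, traceA, bellDiagonal_apply]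
  ring

lemma bellCriterion_bellDiagonal_iff {pI px py pz : ℝ} (hsum : pI + px + py + pz = 1) :
    BellCriterion (bellDiagonal pI px py pz) ↔
      pI ^ 2 + px ^ 2 + py ^ 2 + pz ^ 2 - 1 / 2 ≤ 4 * √(pI * px * py * pz) := by
  simp only [BellCriterion, det_bellDiagonal, trace_bellDiagonal, trace_bellDiagonal_sq,
    Complex.ofReal_re, hsum, ge_iff_le, one_pow, mul_one]

lemma bellCriterion_iff_twoQubitCriterion {pI px py pz : ℝ} (hsum : pI + px + py + pz = 1) :
    BellCriterion (bellDiagonal pI px py pz) ↔ TwoQubitCriterion (bellDiagonal pI px py pz) := by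
  simp only [BellCriterion, TwoQubitCriterion, det_bellDiagonal, trace_bellDiagonal,
    trace_bellDiagonal_sq, trace_traceA_bellDiagonal_sq, Complex.ofReal_re, hsum]
  constructor <;> intro h <;> linarith

/-- The criterion is the square of the quadrilateral inequality. -/
lemma abs_le_iff_le_sqrt {pI px py pz : ℝ} (hI : 0 ≤ pI) (hx : 0 ≤ px) (hy : 0 ≤ py)
    (hz : 0 ≤ pz) (hsum : pI + px + py + pz = 1) :
    |pI + pz - px - py| ≤ 2 * √(pI * pz) + 2 * √(px * py) ↔
      pI ^ 2 + px ^ 2 + py ^ 2 + pz ^ 2 - 1 / 2 ≤ 4 * √(pI * px * py * pz) := by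
  have h1 := Real.sq_sqrt (mul_nonneg hI hz)
  have h2 := Real.sq_sqrt (mul_nonneg hx hy)
  have h3 : √(pI * px * py * pz) = √(pI * pz) * √(px * py) := by
    rw [← Real.sqrt_mul (mul_nonneg hI hz)]
    congr 1
    ring
  have h4 : (pI + px + py + pz) ^ 2 = 1 := by rw [hsum, one_pow]
  rw [← abs_of_nonneg (a := 2 * √(pI * pz) + 2 * √(px * py)) (by positivity), ← sq_le_sq, h3]
  constructor <;> intro h <;> nlinarith

/-! ### Necessity -/

lemma swapBB'_mul_mul_conjTranspose_apply {A B : Type*} [Fintype A] [Fintype B] [DecidableEq A]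
    [DecidableEq B] (τ : Matrix (A × B × B) (A × B × B) ℂ) (i j : A × B × B) :
    (swapBB' A B * τ * (swapBB' A B).conjTranspose) i j =
      τ (i.1, i.2.2, i.2.1) (j.1, j.2.2, j.2.1) := by
  have key : ∀ k l : A × B × B, k = (l.1, l.2.2, l.2.1) ↔ l = (k.1, k.2.2, k.2.1) := by
    rintro ⟨a, b, c⟩ ⟨d, e, f⟩
    simp only [Prod.mk.injEq]
    tauto
  simp [Matrix.mul_apply, swapBB', Matrix.conjTranspose_apply, key, apply_ite]

/-- Positivity of a positive semidefinite matrix on a real combination of two basis vectors. -/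
lemma re_quadratic_nonneg {n : Type*} [Fintype n] [DecidableEq n] {τ : Matrix n n ℂ}
    (hτ : τ.PosSemidef) (i j : n) (c d : ℝ) :
    0 ≤ c ^ 2 * (τ i i).re + c * d * ((τ i j).re + (τ j i).re) + d ^ 2 * (τ j j).re := by
  have h := (Complex.le_def.1 (hτ.dotProduct_mulVec_nonneg
    (Pi.single i (c : ℂ) + Pi.single j (d : ℂ)))).1
  simp [Matrix.mulVec_add, add_dotProduct, dotProduct_add] at h
  linarith

lemma abs_le_two_mul_sqrt {a b m : ℝ} (h : ∀ s t : ℝ, 0 ≤ a * s ^ 2 + m * (s * t) + b * t ^ 2) :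
    |m| ≤ 2 * √(a * b) := by
  have hd : discrim a m b ≤ 0 := discrim_le_zero fun s => by
    have := h s 1
    linarith
  rw [discrim] at hd
  have h0 : 0 ≤ a * b := by nlinarith [sq_nonneg m]
  refine abs_le_of_sq_le_sq ?_ (by positivity)
  rw [mul_pow, Real.sq_sqrt h0]
  linarith

lemma abs_le_of_hasSymmetricExtension {pI px py pz : ℝ}
    (h : HasSymmetricExtension (bellDiagonal pI px py pz)) :
    |pI + pz - px - py| ≤ 2 * √(pI * pz) + 2 * √(px * py) := by
  obtain ⟨τ, ⟨hpos, -⟩, hswap, htr⟩ := h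
  have hs : ∀ i j, τ (i.1, i.2.2, i.2.1) (j.1, j.2.2, j.2.1) = τ i j := fun i j => by
    rw [← swapBB'_mul_mul_conjTranspose_apply τ i j, hswap]
  have s1 := congrArg Complex.re (hs (0, 0, 1) (0, 0, 1))
  have s2 := congrArg Complex.re (hs (1, 0, 1) (1, 0, 1))
  have ht : ∀ i j, (∑ b, τ (i.1, i.2, b) (j.1, j.2, b)).re =
      (bellDiagonal pI px py pz i j).re := fun i j => by rw [← htr]; rfl
  have t1 := ht (0, 0) (0, 0)
  have t2 := ht (1, 1) (1, 1)
  have t3 := ht (0, 0) (1, 1)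
  have t4 := ht (1, 1) (0, 0)
  have t5 := ht (0, 1) (0, 1)
  have t6 := ht (1, 0) (1, 0)
  have t7 := ht (0, 1) (1, 0)
  have t8 := ht (1, 0) (0, 1)
  simp only [bellDiagonal_apply, Complex.ofReal_re, Fin.sum_univ_two, Complex.add_re]
    at t1 t2 t3 t4 t5 t6 t7 t8
  simp at t1 t2 t3 t4 t5 t6 t7 t8 s1 s2
  -- Twice the entry of `τ` between `|Φ⁺⟩|k⟩` and `|Φ⁻⟩σ_z|k⟩`, summed over `k`.
  have hn : |(τ (0, 0, 0) (0, 0, 0)).re + (τ (1, 1, 1) (1, 1, 1)).re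
      - (τ (1, 1, 0) (1, 1, 0)).re - (τ (0, 0, 1) (0, 0, 1)).re| ≤ 2 * √(pI * pz) := by
    refine abs_le_two_mul_sqrt fun s t => ?_
    have e1 := re_quadratic_nonneg hpos (0, 0, 0) (1, 1, 0) (s + t) (s - t)
    have e2 := re_quadratic_nonneg hpos (0, 0, 1) (1, 1, 1) (s - t) (s + t)
    linear_combination (1 / 2) * e1 + (1 / 2) * e2 + (s ^ 2 + t ^ 2) / 2 * (t1 + t2)
      + (s ^ 2 - t ^ 2) / 2 * (t3 + t4)
  -- The same for `|Ψ⁺⟩|k⟩` and `|Ψ⁻⟩σ_z|k⟩`, up to sign.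
  have hm : |(τ (0, 1, 1) (0, 1, 1)).re + (τ (1, 0, 0) (1, 0, 0)).re
      - (τ (1, 0, 1) (1, 0, 1)).re - (τ (0, 1, 0) (0, 1, 0)).re| ≤ 2 * √(px * py) := by
    refine abs_le_two_mul_sqrt fun s t => ?_
    have e1 := re_quadratic_nonneg hpos (0, 1, 1) (1, 0, 1) (s + t) (s - t)
    have e2 := re_quadratic_nonneg hpos (0, 1, 0) (1, 0, 0) (s - t) (s + t)
    linear_combination (1 / 2) * e1 + (1 / 2) * e2 + (s ^ 2 + t ^ 2) / 2 * (t5 + t6)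
      + (s ^ 2 - t ^ 2) / 2 * (t7 + t8)
  rw [abs_le] at *
  constructor <;> linarith

/-! ### Sufficiency -/

/-- Two sides `z`, `w` of a triangle in `ℂ` with lengths `a`, `b` whose sum is the third side
`L ≥ 0`, recorded through `u = z - w`: the two equations are the parallelogram law and
`Re ((z + w) * conj (z - w)) = |z|² - |w|²`. -/
lemma exists_triangle {a b L : ℝ} (h1 : |a - b| ≤ L) (h2 : L ≤ a + b) :
    ∃ u : ℂ, Complex.normSq u + L ^ 2 = 2 * (a ^ 2 + b ^ 2) ∧ L * u.re = a ^ 2 - b ^ 2 := by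
  have hL : 0 ≤ L := (abs_nonneg _).trans h1
  rw [abs_le] at h1
  rcases hL.eq_or_lt with rfl | hL
  · have : a = b := by linarith
    subst this
    refine ⟨⟨2 * a, 0⟩, ?_, ?_⟩
    · rw [Complex.normSq_mk]
      ring
    · ring
  · have key : (a ^ 2 - b ^ 2) ^ 2 ≤ L ^ 2 * (2 * (a ^ 2 + b ^ 2) - L ^ 2) := by
      -- The difference is Heron's product.
      have := mul_nonneg (mul_nonneg (sub_nonneg.2 h2) (by linarith : 0 ≤ a + b + L))
        (mul_nonneg (sub_nonneg.2 h1.2) (by linarith : 0 ≤ L + (a - b)))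
      linarith
    have hnn : 0 ≤ 2 * (a ^ 2 + b ^ 2) - L ^ 2 - ((a ^ 2 - b ^ 2) / L) ^ 2 := by
      rw [sub_nonneg, div_pow, div_le_iff₀ (by positivity)]
      linarith
    refine ⟨⟨(a ^ 2 - b ^ 2) / L, √(2 * (a ^ 2 + b ^ 2) - L ^ 2 - ((a ^ 2 - b ^ 2) / L) ^ 2)⟩,
      ?_, mul_div_cancel₀ _ hL.ne'⟩
    rw [Complex.normSq_mk, Real.mul_self_sqrt hnn]
    ring

/-- Up to normalization, the component with `k = 0` of the extension:
`u|000⟩ + t|011⟩ + L(|101⟩ + |110⟩)`. -/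
def extVec₀ (u t : ℂ) (L : ℝ) : Fin 2 × Fin 2 × Fin 2 → ℂ := fun i =>
  if i.1 = 0 then (if i.2 = (0, 0) then u else if i.2 = (1, 1) then t else 0)
  else (if i.2.1 = i.2.2 then 0 else (L : ℂ))

/-- Up to normalization, the component with `k = 1` of the extension:
`u|111⟩ + t|100⟩ + L(|001⟩ + |010⟩)`. -/
def extVec₁ (u t : ℂ) (L : ℝ) : Fin 2 × Fin 2 × Fin 2 → ℂ := fun i =>
  if i.1 = 1 then (if i.2 = (1, 1) then u else if i.2 = (0, 0) then t else 0)
  else (if i.2.1 = i.2.2 then 0 else (L : ℂ))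

lemma extVec₀_swap (u t : ℂ) (L : ℝ) (i : Fin 2 × Fin 2 × Fin 2) :
    extVec₀ u t L (i.1, i.2.2, i.2.1) = extVec₀ u t L i := by
  obtain ⟨a, b, c⟩ := i
  fin_cases a <;> fin_cases b <;> fin_cases c <;> simp [extVec₀]

lemma extVec₁_swap (u t : ℂ) (L : ℝ) (i : Fin 2 × Fin 2 × Fin 2) :
    extVec₁ u t L (i.1, i.2.2, i.2.1) = extVec₁ u t L i := by
  obtain ⟨a, b, c⟩ := i
  fin_cases a <;> fin_cases b <;> fin_cases c <;> simp [extVec₁]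

/-- The symmetric extension built from the two sides of a quadrilateral. -/
def extState (u t : ℂ) (L : ℝ) : Matrix (Fin 2 × Fin 2 × Fin 2) (Fin 2 × Fin 2 × Fin 2) ℂ :=
  (1 / 4 : ℝ) • (proj (extVec₀ u t L) + proj (extVec₁ u t L))

lemma extState_posSemidef (u t : ℂ) (L : ℝ) : (extState u t L).PosSemidef :=
  ((Matrix.posSemidef_vecMulVec_self_star _).add
    (Matrix.posSemidef_vecMulVec_self_star _)).smul (by norm_num)

lemma extState_swap (u t : ℂ) (L : ℝ) :
    swapBB' (Fin 2) (Fin 2) * extState u t L * (swapBB' (Fin 2) (Fin 2)).conjTranspose =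
      extState u t L := by
  ext i j
  rw [swapBB'_mul_mul_conjTranspose_apply]
  simp only [extState, proj, Matrix.smul_apply, Matrix.add_apply, Matrix.vecMulVec_apply,
    Pi.star_apply, extVec₀_swap, extVec₁_swap]

lemma traceB'_extState {pI px py pz L : ℝ} {u t : ℂ}
    (hu : Complex.normSq u + L ^ 2 = 2 * (pI + pz)) (hu' : L * u.re = pI - pz)
    (ht : Complex.normSq t + L ^ 2 = 2 * (px + py)) (ht' : L * t.re = px - py) :
    traceB' (extState u t L) = bellDiagonal pI px py pz := by
  rw [Complex.normSq_apply] at hu ht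
  ext i j
  obtain ⟨a, b⟩ := i
  obtain ⟨c, d⟩ := j
  rw [bellDiagonal_apply]
  fin_cases a <;> fin_cases b <;> fin_cases c <;> fin_cases d <;>
    simp [traceB', extState, proj, extVec₀, extVec₁, Matrix.vecMulVec_apply, Complex.ext_iff] <;>
    constructor <;> linarith

lemma trace_traceB' {A B : Type*} [Fintype A] [Fintype B]
    (τ : Matrix (A × B × B) (A × B × B) ℂ) : (traceB' τ).trace = τ.trace := by
  simp [Matrix.trace, traceB', Fintype.sum_prod_type]

lemma hasSymmetricExtension_of_abs_le {pI px py pz : ℝ} (hI : 0 ≤ pI) (hx : 0 ≤ px)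
    (hy : 0 ≤ py) (hz : 0 ≤ pz) (hsum : pI + px + py + pz = 1)
    (h : |pI + pz - px - py| ≤ 2 * √(pI * pz) + 2 * √(px * py)) :
    HasSymmetricExtension (bellDiagonal pI px py pz) := by
  rw [Real.sqrt_mul hI, Real.sqrt_mul hx, abs_le] at h
  have sI := Real.sq_sqrt hI
  have sx := Real.sq_sqrt hx
  have sy := Real.sq_sqrt hy
  have sz := Real.sq_sqrt hz
  have nI := Real.sqrt_nonneg pI
  have nx := Real.sqrt_nonneg px
  have ny := Real.sqrt_nonneg py
  have nz := Real.sqrt_nonneg pz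
  have h1 : |√pI - √pz| ≤ √px + √py := by
    refine abs_le_of_sq_le_sq ?_ (by positivity)
    nlinarith
  have h2 : |√px - √py| ≤ √pI + √pz := by
    refine abs_le_of_sq_le_sq ?_ (by positivity)
    nlinarith
  have h3 : |√pI - √pz| ≤ √pI + √pz := abs_le.2 ⟨by linarith, by linarith⟩
  have h4 : |√px - √py| ≤ √px + √py := abs_le.2 ⟨by linarith, by linarith⟩
  -- The smallest length of a diagonal for which both triangles exist.
  obtain ⟨u, hu, hu'⟩ := exists_triangle (le_max_left |√pI - √pz| |√px - √py|) (max_le h3 h2)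
  obtain ⟨t, ht, ht'⟩ := exists_triangle (le_max_right |√pI - √pz| |√px - √py|) (max_le h1 h4)
  rw [sI, sz] at hu hu'
  rw [sx, sy] at ht ht'
  have htr := traceB'_extState hu hu' ht ht'
  refine ⟨_, ⟨extState_posSemidef u t _, ?_⟩, extState_swap u t _, htr⟩
  rw [← trace_traceB', htr, trace_bellDiagonal, hsum, Complex.ofReal_one]

/-! ### The three scalar conditions -/

lemma cond3_iff_cond2_neg (a b c : ℝ) : Cond3 a b c ↔ Cond2 (-a) c b := by
  simp only [Cond2, Cond3]
  constructor <;> rintro ⟨h1, h2⟩ <;> constructor <;> linarith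

lemma cond1_iff_cond1_neg (a b c : ℝ) : Cond1 a b c ↔ Cond1 (-a) c b := by
  simp only [Cond1]
  constructor <;> intro h <;> linarith

/-- The first condition is a comparison of squares. -/
lemma cond1_iff_sq_le (a b c : ℝ) : Cond1 a b c ↔
    (a ^ 2 + b ^ 2 + c ^ 2 - 1) ^ 2 ≤
      ((1 + a) ^ 2 - 2 * b ^ 2) * ((1 - a) ^ 2 - 2 * c ^ 2) := by
  simp only [Cond1]
  constructor <;> intro h <;> linarith

lemma Cond2.norm_sq_le_one {a b c : ℝ} (h : Cond2 a b c) (ha : |a| ≤ 1)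
    (hA : 2 * b ^ 2 ≤ (1 + a) ^ 2) : a ^ 2 + b ^ 2 + c ^ 2 ≤ 1 := by
  obtain ⟨h1, -⟩ := h
  have h2 := Real.sq_sqrt (show (0 : ℝ) ≤ 2 by norm_num)
  have hs := Real.sqrt_nonneg (2 : ℝ)
  rw [abs_le] at ha
  have hb := abs_nonneg b
  rw [← sq_abs b] at hA h1 ⊢
  -- With `x = √2 |b| ≤ 1 + a`, the claim follows from `(x - a)² ≤ 1`.
  have hx : √2 * |b| ≤ 1 + a := by
    refine abs_le_of_sq_le_sq' ?_ (by linarith) |>.2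
    rw [mul_pow, h2]
    exact hA
  have hx0 : 0 ≤ √2 * |b| := by positivity
  have hx2 : (√2 * |b|) ^ 2 = 2 * |b| ^ 2 := by rw [mul_pow, h2]
  nlinarith

/-- For fixed `b² + c² = 1 - r²` the first condition is a quadratic inequality in `b² - c²`, which
holds between the roots `2a(1 - r)` and `2a(1 + r)`. Failure of the third condition gives
`b² - c²` the lower bound, failure of the second the upper one. -/
lemma conditions_of_norm_sq_le_one_of_pos {a b c : ℝ} (ha : 0 < a)
    (hR : a ^ 2 + b ^ 2 + c ^ 2 ≤ 1) : Cond1 a b c ∨ Cond2 a b c ∨ Cond3 a b c := by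
  by_contra! hcon
  obtain ⟨n1, n2, n3⟩ := hcon
  apply n1
  have h2 := Real.sq_sqrt (show (0 : ℝ) ≤ 2 by norm_num)
  have hs : 0 < √2 := by positivity
  have hb := abs_nonneg b
  have hc := abs_nonneg c
  have e3 : 2 * √2 * a * |c| < b ^ 2 - c ^ 2 := by
    by_contra! h
    exact n3 ⟨by linarith, by positivity⟩
  have hd : 0 < b ^ 2 - c ^ 2 := lt_of_le_of_lt (by positivity) e3
  have e2 : b ^ 2 - c ^ 2 < 2 * √2 * a * |b| := by
    by_contra! h
    refine n2 ⟨by linarith, ?_⟩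
    have hb0 : 0 < |b| := abs_pos.2 fun h0 => by
      subst h0
      nlinarith [sq_nonneg c]
    have hc2 := sq_nonneg c
    rw [← sq_abs b] at h
    by_contra! h'
    nlinarith
  have q2 : (b ^ 2 - c ^ 2) ^ 2 < 8 * a ^ 2 * b ^ 2 := by
    have := pow_lt_pow_left₀ e2 hd.le two_ne_zero
    rw [mul_pow, mul_pow, mul_pow, h2, sq_abs] at this
    linarith
  have q3 : 8 * a ^ 2 * c ^ 2 < (b ^ 2 - c ^ 2) ^ 2 := by
    have := pow_lt_pow_left₀ e3 (by positivity) two_ne_zero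
    rw [mul_pow, mul_pow, mul_pow, h2, sq_abs] at this
    linarith
  set r := √(1 - b ^ 2 - c ^ 2) with hr
  have hr2 : r ^ 2 = 1 - b ^ 2 - c ^ 2 := Real.sq_sqrt (by nlinarith)
  have har : a ≤ r := Real.le_sqrt_of_sq_le (by linarith)
  have hr1 : r ≤ 1 := Real.sqrt_le_one.2 (by nlinarith)
  clear_value r
  set d := b ^ 2 - c ^ 2 with hd'
  have hb2 : b ^ 2 = (1 - r ^ 2 + d) / 2 := by linarith
  have hc2 : c ^ 2 = (1 - r ^ 2 - d) / 2 := by linarith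
  rw [hb2] at q2
  rw [hc2] at q3
  have lower : 2 * a * (1 - r) ≤ d := by
    by_contra! h
    have h5 : (d + 2 * a ^ 2) ^ 2 ≤ (2 * a * (1 - r + a)) ^ 2 :=
      pow_le_pow_left₀ (by positivity) (by linarith) 2
    have h6 : 0 ≤ a ^ 2 * ((r - a) * (1 - r)) :=
      mul_nonneg (sq_nonneg a) (mul_nonneg (by linarith) (by linarith))
    linarith
  have upper : d ≤ 2 * a * (1 + r) := by
    by_contra! h
    have h5 : (2 * a * (1 + r - a)) ^ 2 ≤ (d - 2 * a ^ 2) ^ 2 :=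
      pow_le_pow_left₀ (mul_nonneg (by positivity) (by linarith)) (by linarith) 2
    have h6 : 0 ≤ a ^ 2 * ((r - a) * (1 + r)) :=
      mul_nonneg (sq_nonneg a) (mul_nonneg (by linarith) (by linarith))
    linarith
  have := mul_nonneg (sub_nonneg.2 lower) (sub_nonneg.2 upper)
  have hbc : b ^ 2 + c ^ 2 = 1 - r ^ 2 := by linarith
  simp only [Cond1, ge_iff_le, ← hd', hbc]
  linarith

lemma conditions_of_norm_sq_le_one {a b c : ℝ} (hR : a ^ 2 + b ^ 2 + c ^ 2 ≤ 1) :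
    Cond1 a b c ∨ Cond2 a b c ∨ Cond3 a b c := by
  rcases lt_trichotomy a 0 with ha | rfl | ha
  · have h := conditions_of_norm_sq_le_one_of_pos (a := -a) (b := c) (c := b)
      (by linarith) (by linarith [neg_sq a])
    rw [cond3_iff_cond2_neg (-a), neg_neg, ← cond1_iff_cond1_neg, ← cond3_iff_cond2_neg] at h
    tauto
  · rcases le_total (b ^ 2) (c ^ 2) with h | h
    · exact Or.inr (Or.inr ⟨by simpa using h, by simp⟩)
    · exact Or.inr (Or.inl ⟨by simpa using h, by simp⟩)
  · exact conditions_of_norm_sq_le_one_of_pos ha hR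

lemma conditions_iff_le_sqrt {a b c : ℝ} (ha : |a| ≤ 1) (hA : 2 * b ^ 2 ≤ (1 + a) ^ 2)
    (hB : 2 * c ^ 2 ≤ (1 - a) ^ 2) :
    (Cond1 a b c ∨ Cond2 a b c ∨ Cond3 a b c) ↔
      a ^ 2 + b ^ 2 + c ^ 2 - 1 ≤
        √(((1 + a) ^ 2 - 2 * b ^ 2) * ((1 - a) ^ 2 - 2 * c ^ 2)) := by
  constructor
  · rintro (h | h | h)
    · exact Real.le_sqrt_of_sq_le ((cond1_iff_sq_le a b c).1 h)
    · exact (sub_nonpos.2 (h.norm_sq_le_one ha hA)).trans (Real.sqrt_nonneg _)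
    · have := ((cond3_iff_cond2_neg a b c).1 h).norm_sq_le_one (by rwa [abs_neg])
        (by rwa [← sub_eq_add_neg])
      exact le_trans (by linarith [neg_sq a]) (Real.sqrt_nonneg _)
  · intro h
    rcases le_total (a ^ 2 + b ^ 2 + c ^ 2) 1 with hR | hR
    · exact conditions_of_norm_sq_le_one hR
    · left
      rw [cond1_iff_sq_le]
      have hnn := mul_nonneg (sub_nonneg.2 hA) (sub_nonneg.2 hB)
      exact by simpa only [Real.sq_sqrt hnn] using pow_le_pow_left₀ (sub_nonneg.2 hR) h 2

/-- The right-hand inequality is `R ≤ √(A B)` in terms of the Bell weights. -/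
lemma conditions_iff_le_sqrt_weights {pI px py pz α₁ α₂ α₃ : ℝ} (hI : 0 ≤ pI) (hx : 0 ≤ px)
    (hy : 0 ≤ py) (hz : 0 ≤ pz) (hsum : pI + px + py + pz = 1) (h₁ : α₁ = pI - px - py + pz)
    (h₂ : α₂ = √2 * (pI - pz)) (h₃ : α₃ = √2 * (px - py)) :
    (Cond1 α₁ α₂ α₃ ∨ Cond2 α₁ α₂ α₃ ∨ Cond3 α₁ α₂ α₃) ↔
      pI ^ 2 + px ^ 2 + py ^ 2 + pz ^ 2 - 1 / 2 ≤ 4 * √(pI * px * py * pz) := by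
  have h2 := Real.sq_sqrt (show (0 : ℝ) ≤ 2 by norm_num)
  have q2 : α₂ ^ 2 = 2 * (pI - pz) ^ 2 := by rw [h₂, mul_pow, h2]
  have q3 : α₃ ^ 2 = 2 * (px - py) ^ 2 := by rw [h₃, mul_pow, h2]
  have hp : 1 + α₁ = 2 * (pI + pz) := by linarith
  have hm : 1 - α₁ = 2 * (px + py) := by linarith
  have hA : (1 + α₁) ^ 2 - 2 * α₂ ^ 2 = 16 * (pI * pz) := by
    rw [hp, q2]
    ring
  have hB : (1 - α₁) ^ 2 - 2 * α₃ ^ 2 = 16 * (px * py) := by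
    rw [hm, q3]
    ring
  have hIz := mul_nonneg hI hz
  have hxy := mul_nonneg hx hy
  rw [conditions_iff_le_sqrt (abs_le.2 ⟨by linarith, by linarith⟩) (by linarith) (by linarith),
    hA, hB, show 16 * (pI * pz) * (16 * (px * py)) = 16 ^ 2 * (pI * px * py * pz) by ring,
    Real.sqrt_mul (by norm_num), Real.sqrt_sq (by norm_num)]
  have hR : α₁ ^ 2 + α₂ ^ 2 + α₃ ^ 2 - 1 =
      4 * (pI ^ 2 + px ^ 2 + py ^ 2 + pz ^ 2 - 1 / 2) := by
    rw [q2, q3]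
    linear_combination (1 / 2) * (1 + α₁ + 2 * (pI + pz)) * hp
      + (1 / 2) * (1 - α₁ + 2 * (px + py)) * hm
  rw [hR]
  constructor <;> intro h <;> linarith

end SymExt

end

theorem mainTheorem5
    (pI px py pz : ℝ) (hI : 0 ≤ pI) (hx : 0 ≤ px) (hy : 0 ≤ py) (hz : 0 ≤ pz)
    (hsum : pI + px + py + pz = 1)
    (ρ : Matrix (Fin 2 × Fin 2) (Fin 2 × Fin 2) ℂ) (hρ : ρ = SymExt.bellDiagonal pI px py pz)
    (α₁ α₂ α₃ : ℝ) (h₁ : α₁ = pI - px - py + pz)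
    (h₂ : α₂ = √2 * (pI - pz)) (h₃ : α₃ = √2 * (px - py)) :
    (SymExt.HasSymmetricExtension ρ ↔
      SymExt.Cond1 α₁ α₂ α₃ ∨ SymExt.Cond2 α₁ α₂ α₃ ∨ SymExt.Cond3 α₁ α₂ α₃) ∧
    ((SymExt.Cond1 α₁ α₂ α₃ ∨ SymExt.Cond2 α₁ α₂ α₃ ∨ SymExt.Cond3 α₁ α₂ α₃) ↔
      SymExt.BellCriterion ρ) ∧
    (SymExt.BellCriterion ρ ↔ SymExt.TwoQubitCriterion ρ) := by
  subst hρ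
  have hcond := SymExt.conditions_iff_le_sqrt_weights hI hx hy hz hsum h₁ h₂ h₃
  have hbell := SymExt.bellCriterion_bellDiagonal_iff hsum
  have habs := SymExt.abs_le_iff_le_sqrt hI hx hy hz hsum
  exact ⟨⟨fun h => hcond.2 (habs.1 (SymExt.abs_le_of_hasSymmetricExtension h)),
      fun h => SymExt.hasSymmetricExtension_of_abs_le hI hx hy hz hsum (habs.2 (hcond.1 h))⟩,
    hcond.trans hbell.symm, SymExt.bellCriterion_iff_twoQubitCriterion hsum⟩
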